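/- Let $G$ be a second countable, locally compact (Hausdorff) group with left Haar measure $\mu_G$, and let $\lambda_G$ be its left regular representation on $L^2(G)=L^2(G,\mu_G;\mathbb{C})$, $(\lambda_G(x)f)(y)=f(x^{-1}y)$. A family $(\eta_i)_{i\in I}$ in a Hilbert space $\mathcal H$ is called a frame if there are constants $0<A\le B<\infty$ with $A\|f\|^2\le\sum_{i\in I}|\langle f,\eta_i\rangle|^2\le B\|f\|^2$ for all $f\in\mathcal H$. The group $G$ is called an FT group if there exist a set $\Gamma\subset G$ and $\varphi\in L^2(G)$ such that $(\lambda_G(x)\varphi)_{x\in\Gamma}$ is a frame of $L^2(G)$. A unitary representation $\pi$ is said to have infinite multiplicity if $\pi$ is unitarily equivalent to $\infty\cdot\pi$, the Hilbert space direct sum of countably infinitely many copies of $\pi$. **Theorem.** Let $H<G$ be a closed subgroup that is an FT group (with respect to its own left Haar measure and left regular representation $\lambda_H$), and suppose that $\lambda_H$ has infinite multiplicity. Then $G$ is an FT group. In fact, there exist $\varphi\in L^2(G)$ and a subset $\Gamma\subset H$ such that $(\lambda_G(x)\varphi)_{x\in\Gamma}$ is a frame of $L^2(G)$. -/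

import Mathlib

open MeasureTheory
open scoped ENNReal

/-- A family `(η i)` in a complex Hilbert space is a frame if there are constants
`0 < A ≤ B < ∞` with `A ‖f‖² ≤ ∑ i, |⟨f, η i⟩|² ≤ B ‖f‖²` for all `f`. The series is required to
converge, so that the upper bound is the genuine one. -/
def IsFrame {ι E : Type*} [NormedAddCommGroup E] [InnerProductSpace ℂ E] (η : ι → E) : Prop :=
  ∃ A B : ℝ, 0 < A ∧ A ≤ B ∧ ∀ f : E,
    Summable (fun i => ‖inner ℂ f (η i)‖ ^ 2) ∧
    A * ‖f‖ ^ 2 ≤ ∑' i, ‖inner ℂ f (η i)‖ ^ 2 ∧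
    ∑' i, ‖inner ℂ f (η i)‖ ^ 2 ≤ B * ‖f‖ ^ 2

/-- Unitary equivalence of two unitary representations of the same group. -/
def UnitarilyEquivalent {G E F : Type*} [Group G]
    [NormedAddCommGroup E] [InnerProductSpace ℂ E]
    [NormedAddCommGroup F] [InnerProductSpace ℂ F]
    (π : G →* (E ≃ₗᵢ[ℂ] E)) (ρ : G →* (F ≃ₗᵢ[ℂ] F)) : Prop :=
  ∃ U : E ≃ₗᵢ[ℂ] F, ∀ (g : G) (v : E), U (π g v) = ρ g (U v)

section Amplification

variable {E : Type*} [NormedAddCommGroup E] [InnerProductSpace ℂ E]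

/-- A unitary operator applied in every coordinate of the Hilbert direct sum `ℓ²(ℕ, E)` of
countably many copies of `E`, as a linear map. -/
noncomputable def lpMapLinear (T : E ≃ₗᵢ[ℂ] E) :
    lp (fun _ : ℕ => E) 2 →ₗ[ℂ] lp (fun _ : ℕ => E) 2 where
  toFun u := ⟨fun n => T (u n), (lp.memℓp u).mono' (fun n => by simp)⟩
  map_add' u v := by ext n; exact map_add T (u n) (v n)
  map_smul' c u := by ext n; exact map_smul T c (u n)

/-- The coordinatewise operator as a unitary operator of `ℓ²(ℕ, E)`. -/
noncomputable def lpMapUnitary (T : E ≃ₗᵢ[ℂ] E) :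
    lp (fun _ : ℕ => E) 2 ≃ₗᵢ[ℂ] lp (fun _ : ℕ => E) 2 where
  toLinearEquiv := LinearEquiv.ofLinearMap (lpMapLinear T) (lpMapLinear T.symm)
    (by ext u n; simp [lpMapLinear]) (by ext u n; simp [lpMapLinear])
  norm_map' u := by
    have h : (0 : ℝ) < (2 : ℝ≥0∞).toReal := by norm_num
    rw [lp.norm_eq_tsum_rpow h, lp.norm_eq_tsum_rpow h]
    simp [lpMapLinear]

/-- The representation `∞ · π`: the Hilbert direct sum of countably infinitely many copies of
`π`, acting on `ℓ²(ℕ, E)` by `((∞ · π)(g) u) n = π(g) (u n)`. -/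
noncomputable def infiniteMultiple {G : Type*} [Group G] (π : G →* (E ≃ₗᵢ[ℂ] E)) :
    G →* (lp (fun _ : ℕ => E) 2 ≃ₗᵢ[ℂ] lp (fun _ : ℕ => E) 2) where
  toFun g := lpMapUnitary (π g)
  map_one' := by ext u n; simp [lpMapUnitary, lpMapLinear]
  map_mul' g h := by ext u n; simp [lpMapUnitary, lpMapLinear]

/-- `π` has infinite multiplicity if `π ≃ ∞ · π`. -/
def HasInfiniteMultiplicity {G : Type*} [Group G] (π : G →* (E ≃ₗᵢ[ℂ] E)) : Prop :=
  UnitarilyEquivalent π (infiniteMultiple π)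

end Amplification

section LeftRegular

variable {G : Type*} [Group G] [MeasurableSpace G] [MeasurableMul G]

/-- Left translation of `f ∈ L²(G)` by `x`, that is `y ↦ f (x⁻¹ * y)`, as a linear map. -/
noncomputable def leftTranslate (μ : Measure G) [μ.IsMulLeftInvariant] (x : G) :
    Lp ℂ 2 μ →ₗ[ℂ] Lp ℂ 2 μ :=
  Lp.compMeasurePreservingₗ ℂ (fun y => x⁻¹ * y) (measurePreserving_mul_left μ x⁻¹)

theorem leftTranslate_coeFn (μ : Measure G) [μ.IsMulLeftInvariant] (x : G) (f : Lp ℂ 2 μ) :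
    leftTranslate μ x f =ᵐ[μ] fun y => f (x⁻¹ * y) :=
  Lp.coeFn_compMeasurePreserving f (measurePreserving_mul_left μ x⁻¹)

theorem leftTranslate_one (μ : Measure G) [μ.IsMulLeftInvariant] (f : Lp ℂ 2 μ) :
    leftTranslate μ 1 f = f := by
  apply Lp.ext
  filter_upwards [leftTranslate_coeFn μ 1 f] with y hy
  simpa using hy

theorem leftTranslate_mul (μ : Measure G) [μ.IsMulLeftInvariant] (a b : G) (f : Lp ℂ 2 μ) :
    leftTranslate μ (a * b) f = leftTranslate μ a (leftTranslate μ b f) := by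
  apply Lp.ext
  filter_upwards [leftTranslate_coeFn μ (a * b) f, leftTranslate_coeFn μ a (leftTranslate μ b f),
    (measurePreserving_mul_left μ a⁻¹).quasiMeasurePreserving.ae (leftTranslate_coeFn μ b f)]
    with y h1 h2 h3
  rw [h1, h2, h3, mul_inv_rev, mul_assoc]

/-- The left regular representation of `G` on `L²(G)`, `(λ(x) f)(y) = f (x⁻¹ * y)`. -/
noncomputable def leftRegular (μ : Measure G) [μ.IsMulLeftInvariant] :
    G →* (Lp ℂ 2 μ ≃ₗᵢ[ℂ] Lp ℂ 2 μ) where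
  toFun x :=
    { toLinearEquiv := LinearEquiv.ofLinearMap (leftTranslate μ x) (leftTranslate μ x⁻¹)
        (LinearMap.ext fun f => by
          simp only [LinearMap.comp_apply, LinearMap.id_apply]
          rw [← leftTranslate_mul, mul_inv_cancel, leftTranslate_one])
        (LinearMap.ext fun f => by
          simp only [LinearMap.comp_apply, LinearMap.id_apply]
          rw [← leftTranslate_mul, inv_mul_cancel, leftTranslate_one])
      norm_map' := fun f =>
        Lp.norm_compMeasurePreserving f (measurePreserving_mul_left μ x⁻¹) }
  map_one' := LinearIsometryEquiv.ext fun f => leftTranslate_one μ f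
  map_mul' a b := LinearIsometryEquiv.ext fun f => leftTranslate_mul μ a b f

/-- The group `G`, with left Haar measure `μ`, is an FT group (admits a frame of translates) if
`(λ(x) φ)`, `x ∈ Γ`, is a frame of `L²(G)` for some `φ ∈ L²(G)` and some `Γ ⊆ G`. -/
def IsFTGroup (μ : Measure G) [μ.IsMulLeftInvariant] : Prop :=
  ∃ (φ : Lp ℂ 2 μ) (Γ : Set G), IsFrame (fun x : Γ => leftRegular μ (x : G) φ)

end LeftRegular

/-!
The restriction of `λ_G` to `H` embeds isometrically and `H`-equivariantly in `∞ · λ_H`, which is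
`λ_H` by assumption. If `V : L²(G) → L²(H)` denotes the resulting equivariant isometry and
`(λ_H(x) φ)`, `x ∈ Γ`, is a frame of `L²(H)`, then `⟪f, λ_G(x) V† φ⟫ = ⟪V f, λ_H(x) φ⟫` and
`‖V f‖ = ‖f‖`, so `(λ_G(x) V† φ)`, `x ∈ Γ`, is a frame of `L²(G)` with the same bounds
(`IsFrame.image_of_intertwining`). Surjectivity of `V` plays no role, which avoids both a Borel
section of `G → H \ G` and a disintegration of Haar measure.

The embedding is explicit. A Bruhat function (`exists_measurable_lintegral_inv_mul_eq_one`) yields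
`w` on `G` with `∫_H |w(h⁻¹g)|² dh = 1` for all `g`, and then `f ↦ w(g) f(hg)` is an isometry from
`L²(G)` to `L²(H × G)` under which left translation by `H` acts in the variable `h` alone
(`lintegral_lintegral_mul_translate`). Expanding in the variable `g` along a Parseval sequence of
`L²(G)` identifies the target with a part of `ℓ²(ℕ, L²(H))`
(`exists_intertwining_infiniteMultiple`).
-/

/-! ### Frames and equivariant isometries -/

/-- The adjoint of an isometry maps frames to frames, because `⟪f, V† η⟫ = ⟪V f, η⟫` and
`‖V f‖ = ‖f‖`. -/
theorem IsFrame.adjoint {ι E F : Type*} [NormedAddCommGroup E] [InnerProductSpace ℂ E]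
    [CompleteSpace E] [NormedAddCommGroup F] [InnerProductSpace ℂ F] [CompleteSpace F]
    {η : ι → F} (hη : IsFrame η) (V : E →ₗᵢ[ℂ] F) :
    IsFrame fun i => V.toContinuousLinearMap.adjoint (η i) := by
  obtain ⟨A, B, hA, hAB, h⟩ := hη
  refine ⟨A, B, hA, hAB, fun f => ?_⟩
  simpa [ContinuousLinearMap.adjoint_inner_right] using h (V f)

/-- An orbit frame of a representation `σ` of `H` pulls back along an `H`-equivariant isometry
`V : E → F` to an orbit frame of a representation of `G` on `E`, with generator `V† φ`. -/
theorem IsFrame.image_of_intertwining {G E F : Type*} [Group G] {H : Subgroup G}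
    [NormedAddCommGroup E] [InnerProductSpace ℂ E] [CompleteSpace E]
    [NormedAddCommGroup F] [InnerProductSpace ℂ F] [CompleteSpace F]
    (π : G →* (E ≃ₗᵢ[ℂ] E)) (σ : H →* (F ≃ₗᵢ[ℂ] F)) (V : E →ₗᵢ[ℂ] F)
    (hV : ∀ (x : H) f, V (π x f) = σ x (V f)) {Γ : Set H} {φ : F}
    (h : IsFrame fun x : Γ => σ x φ) :
    IsFrame fun x : ((↑) '' Γ : Set G) => π x (V.toContinuousLinearMap.adjoint φ) := by
  have key : ∀ x : H, π x (V.toContinuousLinearMap.adjoint φ) =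
      V.toContinuousLinearMap.adjoint (σ x φ) := by
    intro x
    refine ext_inner_left ℂ fun f => ?_
    obtain ⟨f, rfl⟩ := (π x).surjective f
    rw [LinearIsometryEquiv.inner_map_map, ContinuousLinearMap.adjoint_inner_right,
      ContinuousLinearMap.adjoint_inner_right]
    simp [hV]
  obtain ⟨A, B, hA, hAB, hf⟩ := h.adjoint V
  let e : Γ ≃ ((↑) '' Γ : Set G) := Equiv.Set.image _ Γ Subtype.val_injective
  refine ⟨A, B, hA, hAB, fun f => ?_⟩
  rw [← e.summable_iff, ← e.tsum_eq]
  simpa [e, Function.comp_def, key] using hf f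

/-! ### Parseval sequences and isometries into direct sums -/

/-- A separable Hilbert space has a Parseval sequence. The sequence is an orthonormal basis padded
with zeros, so that finite-dimensional spaces need no separate treatment. -/
theorem exists_seq_tsum_enorm_inner_sq (E : Type*) [NormedAddCommGroup E] [InnerProductSpace ℂ E]
    [CompleteSpace E] [TopologicalSpace.SeparableSpace E] :
    ∃ e : ℕ → E, ∀ v : E, ∑' n, ‖inner ℂ (e n) v‖ₑ ^ 2 = ‖v‖ₑ ^ 2 := by
  obtain ⟨s, b, -⟩ := exists_hilbertBasis ℂ E
  -- Distinct basis vectors are at distance `√2`, hence the basis is countable.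
  have hdisj : Pairwise (Function.onFun Disjoint fun i : s => Metric.ball (b i) (1 / 2)) := by
    intro i j hij
    refine Metric.ball_disjoint_ball ?_
    have h1 : ‖b i - b j‖ ^ 2 = 2 := by
      rw [@norm_sub_sq ℂ, b.orthonormal.1 i, b.orthonormal.1 j, b.orthonormal.2 hij]
      norm_num
    rw [dist_eq_norm]
    nlinarith [norm_nonneg (b i - b j)]
  have : Countable s := hdisj.countable_of_isOpen_disjoint (fun i => Metric.isOpen_ball)
    fun i => ⟨b i, Metric.mem_ball_self (by norm_num)⟩
  obtain ⟨k, hk⟩ := exists_injective_nat s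
  refine ⟨Function.extend k b 0, fun v => ?_⟩
  have h1 : Function.support (fun n => ‖inner ℂ (Function.extend k b 0 n) v‖ₑ ^ 2) ⊆
      Set.range k := by
    intro n hn
    by_contra h
    simp [Function.extend_apply' _ _ _ h] at hn
  rw [← hk.tsum_eq h1]
  simp only [hk.extend_apply]
  have h3 : HasSum (fun i => ‖inner ℂ (b i) v‖ ^ 2) (‖v‖ ^ 2) := by
    simpa [b.repr_apply_apply] using lp.hasSum_norm (p := 2) (by norm_num) (b.repr v)
  have h4 : HasSum (fun i => ‖inner ℂ (b i) v‖₊ ^ 2) (‖v‖₊ ^ 2) :=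
    NNReal.hasSum_coe.1 (by simpa using h3)
  simpa [enorm_eq_nnnorm] using (ENNReal.hasSum_coe.2 h4).tsum_eq

/-- Linear maps `T n` with `∑ ‖T n f‖² = ‖f‖²` are the coordinates of an isometry into the Hilbert
direct sum. -/
theorem exists_linearIsometry_lp {E F : Type*} [NormedAddCommGroup E] [InnerProductSpace ℂ E]
    [NormedAddCommGroup F] [InnerProductSpace ℂ F] (T : ℕ → E →ₗ[ℂ] F)
    (hT : ∀ f, ∑' n, ‖T n f‖ₑ ^ 2 = ‖f‖ₑ ^ 2) :
    ∃ V : E →ₗᵢ[ℂ] lp (fun _ : ℕ => F) 2, ∀ f n, V f n = T n f := by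
  have hs : ∀ f, HasSum (fun n => ‖T n f‖ ^ 2) (‖f‖ ^ 2) := by
    intro f
    have h2 := (ENNReal.summable (f := fun n => ‖T n f‖ₑ ^ 2)).hasSum
    rw [hT f] at h2
    simp only [enorm_eq_nnnorm, ← ENNReal.coe_pow, ENNReal.hasSum_coe] at h2
    simpa using NNReal.hasSum_coe.2 h2
  have hp : (0 : ℝ) < (2 : ℝ≥0∞).toReal := by norm_num
  let L : E →ₗ[ℂ] lp (fun _ : ℕ => F) 2 :=
    { toFun := fun f => ⟨fun n => T n f, memℓp_gen (by simpa using (hs f).summable)⟩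
      map_add' := fun f g => by ext n; exact map_add (T n) f g
      map_smul' := fun c f => by ext n; exact map_smul (T n) c f }
  refine ⟨⟨L, fun f => ?_⟩, fun f n => rfl⟩
  have h3 := lp.norm_rpow_eq_tsum hp (L f)
  have h4 : ∑' n, ‖L f n‖ ^ 2 = ‖f‖ ^ 2 := (hs f).tsum_eq
  simp only [ENNReal.toReal_ofNat, Real.rpow_ofNat] at h3
  rw [h4] at h3
  exact (sq_eq_sq₀ (norm_nonneg _) (norm_nonneg _)).1 h3

/-! ### Bruhat functions -/

open scoped Pointwise in
/-- A Bruhat function for a closed subgroup: a finite measurable weight on `G` whose integral over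
every coset `Hg` is `1`. It is a convergent combination `β` of indicators of relatively compact
open sets exhausting `G`, divided by its coset integral `q`. -/
theorem exists_measurable_lintegral_inv_mul_eq_one {G : Type*} [Group G] [TopologicalSpace G]
    [IsTopologicalGroup G] [T2Space G] [LocallyCompactSpace G] [SecondCountableTopology G]
    [MeasurableSpace G] [BorelSpace G] (H : Subgroup G) (hH : IsClosed (H : Set G))
    (μH : Measure H) [μH.IsHaarMeasure] :
    ∃ ρ : G → ℝ≥0∞, Measurable ρ ∧ (∀ g, ρ g ≠ ∞) ∧
      ∀ g, ∫⁻ h : H, ρ ((h : G)⁻¹ * g) ∂μH = 1 := by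
  have : LocallyCompactSpace H := hH.isClosedEmbedding_subtypeVal.locallyCompactSpace
  have : SigmaCompactSpace H := hH.isClosedEmbedding_subtypeVal.sigmaCompactSpace
  let K := CompactExhaustion.choice G
  -- `M n` bounds, uniformly in `g`, the measure of `{h : H | h⁻¹ g ∈ K n}`; the summand `1` makes
  -- `∑ ε n` converge as well, so that `β` is finite.
  let M : ℕ → ℝ≥0∞ := fun n => μH (Subtype.val ⁻¹' (K n * (K n)⁻¹)) + 1
  have hM : ∀ n, M n ≠ ∞ := fun n => ENNReal.add_ne_top.2
    ⟨(hH.isClosedEmbedding_subtypeVal.isCompact_preimage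
      ((K.isCompact n).mul (K.isCompact n).inv)).measure_lt_top.ne, ENNReal.one_ne_top⟩
  obtain ⟨ε, hε, hsum⟩ := ENNReal.exists_pos_tsum_mul_lt_of_countable one_ne_zero M hM
  let β : G → ℝ≥0∞ := fun g => ∑' n, (interior (K n)).indicator (fun _ => (ε n : ℝ≥0∞)) g
  have hβm : Measurable β := Measurable.tsum fun n =>
    measurable_const.indicator isOpen_interior.measurableSet
  have hβtop : ∀ g, β g ≠ ∞ := by
    intro g
    refine (lt_of_le_of_lt (ENNReal.tsum_le_tsum fun n => ?_) (hsum.trans ENNReal.one_lt_top)).ne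
    refine (Set.indicator_le_self' (fun _ _ => zero_le) g).trans ?_
    exact le_mul_of_one_le_left zero_le le_add_self
  let q : G → ℝ≥0∞ := fun g => ∫⁻ h : H, β ((h : G)⁻¹ * g) ∂μH
  have hqm : Measurable q := by
    refine Measurable.lintegral_prod_right' (f := fun p : G × H => β ((p.2 : G)⁻¹ * p.1)) ?_
    exact hβm.comp ((measurable_subtype_coe.comp measurable_snd).inv.mul measurable_fst)
  have hq : ∀ g, q g = ∑' n, (ε n : ℝ≥0∞) * μH {h : H | (h : G)⁻¹ * g ∈ interior (K n)} := by
    intro g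
    have hS : ∀ n, IsOpen {h : H | (h : G)⁻¹ * g ∈ interior (K n)} := fun n =>
      isOpen_interior.preimage (by fun_prop : Continuous fun h : H => (h : G)⁻¹ * g)
    have h1 : ∀ n, Measurable fun h : H =>
        (interior (K n)).indicator (fun _ => (ε n : ℝ≥0∞)) ((h : G)⁻¹ * g) := fun n =>
      (measurable_const.indicator isOpen_interior.measurableSet).comp (by fun_prop)
    simp only [q, β]
    rw [lintegral_tsum fun n => (h1 n).aemeasurable]
    refine tsum_congr fun n => ?_
    rw [← lintegral_indicator_const (hS n).measurableSet]
    rfl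
  have hqtop : ∀ g, q g ≠ ∞ := by
    intro g
    rw [hq]
    refine (lt_of_le_of_lt (ENNReal.tsum_le_tsum fun n => ?_) (hsum.trans ENNReal.one_lt_top)).ne
    rw [mul_comm]
    gcongr
    refine le_trans ?_ le_self_add
    rcases Set.eq_empty_or_nonempty {h : H | (h : G)⁻¹ * g ∈ interior (K n)} with h0 | ⟨h₀, hh₀⟩
    · simp [h0]
    · -- Translating by a point `h₀` of this set moves it into the set of `h` with
      -- `h ∈ K n * (K n)⁻¹`, which no longer depends on `g`.
      rw [← measure_preimage_mul μH h₀]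
      refine measure_mono fun h hh => ?_
      refine Set.mem_mul.2 ⟨_, interior_subset hh₀, _,
        Set.inv_mem_inv.2 (interior_subset hh), ?_⟩
      simp [mul_assoc]
  have hq0 : ∀ g, q g ≠ 0 := by
    intro g h0
    obtain ⟨n, hn⟩ := K.exists_mem g
    rw [hq, ENNReal.tsum_eq_zero] at h0
    have h1 := (mul_eq_zero.1 (h0 (n + 1))).resolve_left (by simpa using (hε (n + 1)).ne')
    have h2 : IsOpen {h : H | (h : G)⁻¹ * g ∈ interior (K (n + 1))} :=
      isOpen_interior.preimage (by fun_prop : Continuous fun h : H => (h : G)⁻¹ * g)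
    rw [h2.measure_eq_zero_iff μH] at h1
    have : (1 : H) ∈ {h : H | (h : G)⁻¹ * g ∈ interior (K (n + 1))} := by
      simpa using K.subset_interior_succ n hn
    simp [h1] at this
  -- Left invariance of `μH` makes `q` constant on the cosets `Hg`.
  have hqinv : ∀ (h : H) g, q ((h : G)⁻¹ * g) = q g := by
    intro h g
    have := lintegral_mul_left_eq_self (μ := μH) (fun k : H => β ((k : G)⁻¹ * g)) h
    simpa [mul_assoc, q] using this
  refine ⟨fun g => β g * (q g)⁻¹, hβm.mul hqm.inv,
    fun g => ENNReal.mul_ne_top (hβtop g) (ENNReal.inv_ne_top.2 (hq0 g)), fun g => ?_⟩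
  simp only [hqinv]
  rw [lintegral_mul_const _ (f := fun h : H => β ((h : G)⁻¹ * g)) (hβm.comp (by fun_prop))]
  exact ENNReal.mul_inv_cancel (hq0 g) (hqtop g)

/-! ### Embedding the restricted regular representation -/

theorem eLpNorm_two_sq {α E : Type*} [MeasurableSpace α] [NormedAddCommGroup E] (μ : Measure α)
    (f : α → E) : eLpNorm f 2 μ ^ 2 = ∫⁻ a, ‖f a‖ₑ ^ 2 ∂μ := by
  simpa using eLpNorm_nnreal_pow_eq_lintegral (μ := μ) (f := f) (p := 2) two_ne_zero

section TranslateCoeff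

variable {G : Type*} [Group G] [MeasurableSpace G] {H : Subgroup G}

/-- The coefficient `h ↦ ⟪e, w · f (h ·)⟫` on `H`, for functions `w`, `e`, `f` on `G`. It is defined
for functions rather than classes; where the integrand is not integrable its value is `0`. -/
noncomputable def translateCoeff (μG : Measure G) (w e f : G → ℂ) (h : H) : ℂ :=
  ∫ g, inner ℂ (e g) (w g * f (h * g)) ∂μG

variable {μG : Measure G} {μH : Measure H} {w e f : G → ℂ}

theorem integrable_inner_mul_translate {h : H} (e : Lp ℂ 2 μG)
    (hh : MemLp (fun g => w g * f (h * g)) 2 μG) :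
    Integrable (fun g => inner ℂ (e g) (w g * f (h * g))) μG := by
  refine (L2.integrable_inner (𝕜 := ℂ) e hh.toLp).congr ?_
  filter_upwards [hh.coeFn_toLp] with g hg
  rw [hg]

theorem stronglyMeasurable_translateCoeff [MeasurableMul₂ G] [SFinite μG]
    (hw : Measurable w) (he : Measurable e) (hf : Measurable f) :
    StronglyMeasurable (translateCoeff (H := H) μG w e f) := by
  refine StronglyMeasurable.integral_prod_right'
    (f := fun p : H × G => inner ℂ (e p.2) (w p.2 * f (p.1 * p.2)))
    (Measurable.stronglyMeasurable ?_)
  have : Measurable fun p : H × G => (p.1 : G) * p.2 :=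
    (measurable_subtype_coe.comp measurable_fst).mul measurable_snd
  fun_prop

/-- Equality holds at every `h`, not only almost everywhere, since left translation preserves null
sets. -/
theorem translateCoeff_congr [MeasurableMul G] [μG.IsMulLeftInvariant] {f' : G → ℂ}
    (hf : f =ᵐ[μG] f') (h : H) :
    translateCoeff μG w e f h = translateCoeff μG w e f' h := by
  refine integral_congr_ae ?_
  filter_upwards [(measurePreserving_mul_left μG (h : G)).quasiMeasurePreserving.ae hf] with g hg
  rw [hg]

variable [MeasurableMul₂ G] [MeasurableInv G] [SFinite μG] [μG.IsMulLeftInvariant] [SFinite μH]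

/-- The map `f ↦ w(g) f(hg)` is isometric from `L²(G)` to `L²(H × G)`: substituting `g ↦ h⁻¹g` moves
the translation to `w`, whose coset integrals are `1`. -/
theorem lintegral_lintegral_mul_translate (hw : Measurable w)
    (hw1 : ∀ g, ∫⁻ h : H, ‖w ((h : G)⁻¹ * g)‖ₑ ^ 2 ∂μH = 1) (hf : Measurable f) :
    ∫⁻ h : H, ∫⁻ g, ‖w g * f (h * g)‖ₑ ^ 2 ∂μG ∂μH = ∫⁻ g, ‖f g‖ₑ ^ 2 ∂μG := by
  have h1 : ∀ h : H, ∫⁻ g, ‖w g * f (h * g)‖ₑ ^ 2 ∂μG =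
      ∫⁻ g, ‖w ((h : G)⁻¹ * g)‖ₑ ^ 2 * ‖f g‖ₑ ^ 2 ∂μG := by
    intro h
    rw [← lintegral_mul_left_eq_self
      (fun g => ‖w ((h : G)⁻¹ * g)‖ₑ ^ 2 * ‖f g‖ₑ ^ 2) (h : G)]
    simp [mul_pow]
  have h2 : Measurable fun p : H × G => (p.1 : G)⁻¹ * p.2 :=
    (measurable_subtype_coe.comp measurable_fst).inv.mul measurable_snd
  simp only [h1]
  rw [lintegral_lintegral_swap (Measurable.aemeasurable (by fun_prop))]
  refine lintegral_congr fun g => ?_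
  have h3 : Measurable fun h : H => (h : G)⁻¹ * g := measurable_subtype_coe.inv.mul_const g
  rw [lintegral_mul_const _ (by fun_prop), hw1, one_mul]

theorem ae_memLp_mul_translate (hw : Measurable w)
    (hw1 : ∀ g, ∫⁻ h : H, ‖w ((h : G)⁻¹ * g)‖ₑ ^ 2 ∂μH = 1) (hf : Measurable f)
    (hf2 : MemLp f 2 μG) :
    ∀ᵐ h : H ∂μH, MemLp (fun g => w g * f (h * g)) 2 μG := by
  have h0 : Measurable fun p : H × G => (p.1 : G) * p.2 :=
    (measurable_subtype_coe.comp measurable_fst).mul measurable_snd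
  have h1 : ∫⁻ h : H, ∫⁻ g, ‖w g * f (h * g)‖ₑ ^ 2 ∂μG ∂μH ≠ ∞ := by
    rw [lintegral_lintegral_mul_translate hw hw1 hf, ← eLpNorm_two_sq]
    exact ENNReal.pow_ne_top hf2.eLpNorm_ne_top
  have h2 : Measurable fun h : H => ∫⁻ g, ‖w g * f (h * g)‖ₑ ^ 2 ∂μG :=
    Measurable.lintegral_prod_right' (f := fun p : H × G => ‖w p.2 * f (p.1 * p.2)‖ₑ ^ 2)
      (by fun_prop)
  filter_upwards [ae_lt_top h2 h1] with h hh
  refine ⟨Measurable.aestronglyMeasurable (by fun_prop), ?_⟩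
  rw [← eLpNorm_two_sq] at hh
  simpa using hh

/-- The coefficients against a Parseval sequence `e` carry the full norm of `f`: this is Parseval's
identity for `g ↦ w(g) f(hg)`, integrated over `h`. -/
theorem tsum_lintegral_translateCoeff_sq (hw : Measurable w)
    (hw1 : ∀ g, ∫⁻ h : H, ‖w ((h : G)⁻¹ * g)‖ₑ ^ 2 ∂μH = 1) {e : ℕ → Lp ℂ 2 μG}
    (he : ∀ v : Lp ℂ 2 μG, ∑' n, ‖inner ℂ (e n) v‖ₑ ^ 2 = ‖v‖ₑ ^ 2) (f : Lp ℂ 2 μG) :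
    ∑' n, ∫⁻ h : H, ‖translateCoeff μG w (e n) f h‖ₑ ^ 2 ∂μH = ‖f‖ₑ ^ 2 := by
  have hm : ∀ f : Lp ℂ 2 μG, Measurable f := fun f => (Lp.stronglyMeasurable f).measurable
  rw [← lintegral_tsum fun n => ((stronglyMeasurable_translateCoeff hw (hm _)
    (hm f)).measurable.enorm.pow_const 2).aemeasurable, Lp.enorm_def, eLpNorm_two_sq,
    ← lintegral_lintegral_mul_translate hw hw1 (hm f)]
  refine lintegral_congr_ae ?_
  filter_upwards [ae_memLp_mul_translate hw hw1 (hm f) (Lp.memLp f)] with h hh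
  rw [← eLpNorm_two_sq, ← Lp.enorm_toLp hh, ← he]
  refine tsum_congr fun n => ?_
  rw [L2.inner_def, translateCoeff]
  congr 2
  refine integral_congr_ae ?_
  filter_upwards [hh.coeFn_toLp] with g hg
  rw [hg]

/-- The restriction of `λ_G` to `H` embeds isometrically in `∞ · λ_H`. -/
theorem exists_intertwining_infiniteMultiple [MeasurableMul H]
    [TopologicalSpace.SeparableSpace (Lp ℂ 2 μG)] [μH.IsMulLeftInvariant] (hw : Measurable w)
    (hw1 : ∀ g, ∫⁻ h : H, ‖w ((h : G)⁻¹ * g)‖ₑ ^ 2 ∂μH = 1) :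
    ∃ V : Lp ℂ 2 μG →ₗᵢ[ℂ] lp (fun _ : ℕ => Lp ℂ 2 μH) 2, ∀ (x : H) f,
      V (leftRegular μG (x : G) f) = infiniteMultiple (leftRegular μH) x (V f) := by
  obtain ⟨e, he⟩ := exists_seq_tsum_enorm_inner_sq (Lp ℂ 2 μG)
  have hm : ∀ f : Lp ℂ 2 μG, Measurable f := fun f => (Lp.stronglyMeasurable f).measurable
  have hmem : ∀ n (f : Lp ℂ 2 μG), MemLp (translateCoeff μG w (e n) f) 2 μH := by
    intro n f
    refine ⟨(stronglyMeasurable_translateCoeff hw (hm _) (hm f)).aestronglyMeasurable, ?_⟩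
    refine (ENNReal.pow_lt_top_iff.1 ?_).resolve_right two_ne_zero
    rw [eLpNorm_two_sq]
    refine ((ENNReal.le_tsum n).trans_eq (tsum_lintegral_translateCoeff_sq hw hw1 he f)).trans_lt ?_
    simp [ENNReal.pow_lt_top_iff]
  let T : ℕ → Lp ℂ 2 μG →ₗ[ℂ] Lp ℂ 2 μH := fun n =>
    { toFun := fun f => (hmem n f).toLp
      map_add' := fun f g => by
        rw [← MemLp.toLp_add]
        refine MemLp.toLp_congr _ _ ?_
        filter_upwards [ae_memLp_mul_translate hw hw1 (hm f) (Lp.memLp f),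
          ae_memLp_mul_translate hw hw1 (hm g) (Lp.memLp g)] with h hf hg
        rw [translateCoeff_congr (Lp.coeFn_add f g) h, Pi.add_apply, translateCoeff,
          translateCoeff, translateCoeff,
          ← integral_add (integrable_inner_mul_translate (e n) hf)
            (integrable_inner_mul_translate (e n) hg)]
        refine integral_congr_ae (.of_forall fun a => ?_)
        simp only [Pi.add_apply, mul_add, inner_add_right]
      map_smul' := fun c f => by
        rw [RingHom.id_apply, ← MemLp.toLp_const_smul]
        refine MemLp.toLp_congr _ _ (.of_forall fun h => ?_)
        rw [translateCoeff_congr (Lp.coeFn_smul c f) h, Pi.smul_apply, translateCoeff,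
          translateCoeff, smul_eq_mul, ← integral_const_mul]
        refine integral_congr_ae (.of_forall fun a => ?_)
        simp only [Pi.smul_apply, smul_eq_mul, mul_left_comm _ c, ← inner_smul_right] }
  obtain ⟨V, hV⟩ := exists_linearIsometry_lp T fun f => by
    rw [← tsum_lintegral_translateCoeff_sq (μH := μH) hw hw1 he f]
    refine tsum_congr fun n => ?_
    rw [← eLpNorm_two_sq, ← Lp.enorm_toLp (hmem n f)]
    rfl
  refine ⟨V, fun x f => ?_⟩
  ext1
  funext n
  change V _ n = leftRegular μH x (V f n)
  rw [hV, hV]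
  refine Lp.ext ?_
  have h1 := (hmem n f).coeFn_toLp
  filter_upwards [(hmem n (leftRegular μG (x : G) f)).coeFn_toLp,
    leftTranslate_coeFn μH x (T n f),
    (measurePreserving_mul_left μH x⁻¹).quasiMeasurePreserving.ae h1] with h h2 h3 h4
  -- Both sides are the integral of `e n` against `w g * f (x⁻¹ * h * g)`.
  refine h2.trans ((translateCoeff_congr (leftTranslate_coeFn μG (x : G) f) h).trans ?_)
  refine Eq.trans ?_ (h3.trans h4).symm
  simp [translateCoeff, mul_assoc]

end TranslateCoeff

/-! ### Frames of translates from a closed subgroup -/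

theorem mainTheorem3 {G : Type*} [Group G] [TopologicalSpace G] [IsTopologicalGroup G]
    [T2Space G] [LocallyCompactSpace G] [SecondCountableTopology G]
    [MeasurableSpace G] [BorelSpace G]
    (μG : Measure G) [μG.IsHaarMeasure]
    (H : Subgroup G) (hH : IsClosed (H : Set G))
    (μH : Measure H) [μH.IsHaarMeasure]
    (hFT : IsFTGroup μH)
    (hmult : HasInfiniteMultiplicity (leftRegular μH)) :
    IsFTGroup μG ∧
      ∃ (φ : Lp ℂ 2 μG) (Γ : Set G), Γ ⊆ (H : Set G) ∧
        IsFrame (fun x : Γ => leftRegular μG (x : G) φ) := by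
  have : LocallyCompactSpace H := hH.isClosedEmbedding_subtypeVal.locallyCompactSpace
  have : SigmaCompactSpace H := hH.isClosedEmbedding_subtypeVal.sigmaCompactSpace
  have : Fact ((2 : ℝ≥0∞) ≠ ∞) := ⟨ENNReal.ofNat_ne_top⟩
  suffices h : ∃ (φ : Lp ℂ 2 μG) (Γ : Set G), Γ ⊆ (H : Set G) ∧
      IsFrame (fun x : Γ => leftRegular μG (x : G) φ) by
    obtain ⟨φ, Γ, hΓ, hφ⟩ := h
    exact ⟨⟨φ, Γ, hφ⟩, φ, Γ, hΓ, hφ⟩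
  obtain ⟨ρ, hρm, hρtop, hρ⟩ := exists_measurable_lintegral_inv_mul_eq_one H hH μH
  let w : G → ℂ := fun g => (Real.sqrt (ρ g).toReal : ℝ)
  have hw : Measurable w := by fun_prop
  have hwρ : ∀ g, ‖w g‖ₑ ^ 2 = ρ g := by
    intro g
    rw [← ofReal_norm, ← ENNReal.ofReal_pow (norm_nonneg _), Complex.norm_real, Real.norm_eq_abs,
      sq_abs, Real.sq_sqrt ENNReal.toReal_nonneg, ENNReal.ofReal_toReal (hρtop g)]
  obtain ⟨V, hV⟩ := exists_intertwining_infiniteMultiple (μG := μG) (μH := μH) hw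
    (by simpa only [hwρ] using hρ)
  obtain ⟨U, hU⟩ := hmult
  obtain ⟨φ, Γ, hφ⟩ := hFT
  refine ⟨_, (↑) '' Γ, ?_, hφ.image_of_intertwining (leftRegular μG) (leftRegular μH)
    (U.symm.toLinearIsometry.comp V) fun x f => ?_⟩
  · rintro _ ⟨x, -, rfl⟩
    exact x.2
  · apply U.injective
    simp [hU, hV]
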